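/- A *tree-like tableau* is a Young diagram (left-justified rows of weakly decreasing lengths, with no empty row or column) in which some cells contain a point, such that: (1) the top left cell contains a point, called the root; (2) for every non-root pointed cell $c$ there is either a pointed cell above $c$ in the same column or a pointed cell to the left of $c$ in the same row, but not both; (3) every row and every column contains at least one point. Its *size* is its number of points, and $\mathcal{T}_n$ denotes the set of tree-like tableaux of size $n$. For $T\in\mathcal{T}_n$ let $\mathrm{top}(T)$ and $\mathrm{left}(T)$ be the numbers of non-root points in the first row and in the first column of $T$ respectively, let $w(T)=a^{\mathrm{top}(T)}b^{\mathrm{left}(T)}$, and let $T_m(a,b)=\sum_{T\in\mathcal{T}_m}w(T)$. A *non-occupied corner* of $T$ is a cell without a point whose bottom and right edges both lie on the southeast border of the diagram. Let $NOC_{a,b}(\mathcal{T}_n)$ be the set of all non-occupied corners $c$ of tableaux $T\in\mathcal{T}_n$ (that is, of pairs $(T,c)$) such that there is no point above $c$ in the same column except possibly in the first row, and no point to the left of $c$ in the same row except possibly in the first column; the weight of such a corner is $w(c)=w(T)$. **Proposition.** For every $n\ge 3$, $$\sum_{c\in NOC_{a,b}(\mathcal{T}_n)} w(c)=(n-2)\cdot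 ab\cdot T_{n-2}(a,b),\qquad\text{where}\qquad T_{n-2}(a,b)=\prod_{i=0}^{n-4}(a+b+i)=(a+b)(a+b+1)\cdots(a+b+n-4)$$ (the empty product, for $n=3$, being $1$). Here $a,b$ are arbitrary elements of a commutative ring, for example indeterminates. -/

import Mathlib

/-- A tree-like tableau: a Young diagram (rows and columns indexed from `0`, row `0` on top, so
that there are no empty rows or columns) together with a set of pointed cells. The cell in row `i`
and column `j` is `(i, j)`. -/
structure TreeLikeTableau where
  /-- The underlying diagram. -/
  shape : YoungDiagram
  /-- The pointed cells. -/
  points : Finset (ℕ × ℕ)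
  points_subset : points ⊆ shape.cells
  /-- The top left cell is pointed (the root point). -/
  root_mem : ((0, 0) : ℕ × ℕ) ∈ points
  /-- Every non-root pointed cell has either a pointed cell above it in the same column, or a
  pointed cell to its left in the same row, but not both. -/
  parent : ∀ c ∈ points, c ≠ (0, 0) →
    Xor (∃ i < c.1, (i, c.2) ∈ points) (∃ j < c.2, (c.1, j) ∈ points)
  /-- Every row of the diagram contains a pointed cell. -/
  row_pointed : ∀ c ∈ shape.cells, ∃ j, (c.1, j) ∈ points
  /-- Every column of the diagram contains a pointed cell. -/
  col_pointed : ∀ c ∈ shape.cells, ∃ i, (i, c.2) ∈ points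

namespace TreeLikeTableau

/-- The size of a tree-like tableau is its number of points. -/
def size (T : TreeLikeTableau) : ℕ := T.points.card

/-- The number of non-root points in the first row. -/
def top (T : TreeLikeTableau) : ℕ := {c ∈ T.points | c.1 = 0 ∧ c ≠ (0, 0)}.card

/-- The number of non-root points in the first column. -/
def left (T : TreeLikeTableau) : ℕ := {c ∈ T.points | c.2 = 0 ∧ c ≠ (0, 0)}.card

/-- The weight `a ^ top(T) * b ^ left(T)`. -/
def weight {R : Type*} [CommRing R] (a b : R) (T : TreeLikeTableau) : R :=
  a ^ T.top * b ^ T.left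

/-- A corner: a cell whose bottom and right edges both lie on the southeast border. -/
def IsCorner (T : TreeLikeTableau) (c : ℕ × ℕ) : Prop :=
  c ∈ T.shape.cells ∧ (c.1 + 1, c.2) ∉ T.shape.cells ∧ (c.1, c.2 + 1) ∉ T.shape.cells

/-- A non-occupied corner: a corner that is not pointed. -/
def IsNonOccupiedCorner (T : TreeLikeTableau) (c : ℕ × ℕ) : Prop :=
  T.IsCorner c ∧ c ∉ T.points

/-- A non-occupied corner with no point above it in the same column, except possibly in the first
row, and no point to its left in the same row, except possibly in the first column. -/
def IsNOCab (T : TreeLikeTableau) (c : ℕ × ℕ) : Prop :=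
  T.IsNonOccupiedCorner c ∧
    (∀ i < c.1, (i, c.2) ∈ T.points → i = 0) ∧
    (∀ j < c.2, (c.1, j) ∈ T.points → j = 0)

/-- The type of tree-like tableaux of size `n`. -/
abbrev OfSize (n : ℕ) : Type := {T : TreeLikeTableau // T.size = n}

theorem cells_subset (T : TreeLikeTableau) :
    T.shape.cells ⊆ Finset.range T.size ×ˢ Finset.range T.size := by
  intro c hc
  have h1 : Finset.range (c.1 + 1) ⊆ T.points.image Prod.fst := by
    intro i hi
    have hmem : (i, c.2) ∈ T.shape.cells :=
      T.shape.isLowerSet (show ((i, c.2) : ℕ × ℕ) ≤ c from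
        ⟨Nat.lt_succ_iff.1 (Finset.mem_range.1 hi), le_rfl⟩) hc
    obtain ⟨j, hj⟩ := T.row_pointed _ hmem
    exact Finset.mem_image.2 ⟨_, hj, rfl⟩
  have h2 : Finset.range (c.2 + 1) ⊆ T.points.image Prod.snd := by
    intro j hj
    have hmem : (c.1, j) ∈ T.shape.cells :=
      T.shape.isLowerSet (show ((c.1, j) : ℕ × ℕ) ≤ c from
        ⟨le_rfl, Nat.lt_succ_iff.1 (Finset.mem_range.1 hj)⟩) hc
    obtain ⟨i, hi⟩ := T.col_pointed _ hmem
    exact Finset.mem_image.2 ⟨_, hi, rfl⟩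
  have e1 := (Finset.card_le_card h1).trans Finset.card_image_le
  have e2 := (Finset.card_le_card h2).trans Finset.card_image_le
  rw [Finset.card_range] at e1 e2
  exact Finset.mem_product.2 ⟨Finset.mem_range.2 e1, Finset.mem_range.2 e2⟩

instance finite_ofSize (n : ℕ) : Finite (OfSize n) := by
  let box : Finset (ℕ × ℕ) := Finset.range n ×ˢ Finset.range n
  have hbox : ∀ T : OfSize n, T.1.shape.cells ⊆ box := fun T => by
    have h := T.1.cells_subset
    rwa [T.2] at h
  let f : OfSize n → {s // s ∈ box.powerset} × {s // s ∈ box.powerset} := fun T =>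
    (⟨T.1.shape.cells, Finset.mem_powerset.2 (hbox T)⟩,
      ⟨T.1.points, Finset.mem_powerset.2 (T.1.points_subset.trans (hbox T))⟩)
  refine Finite.of_injective f ?_
  rintro ⟨⟨⟨s, hs⟩, p, _, _, _, _, _⟩, hT⟩ ⟨⟨⟨s', hs'⟩, p', _, _, _, _, _⟩, hT'⟩ h
  simp only [f, Prod.mk.injEq, Subtype.mk.injEq] at h
  obtain ⟨h1, h2⟩ := h
  subst h1 h2
  rfl

noncomputable instance fintypeOfSize (n : ℕ) : Fintype (OfSize n) := Fintype.ofFinite _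

open Classical in
/-- The set of pairs (tableau of size `n`, cell of it) such that the cell is a non-occupied corner
with no point above it outside the first row and no point to its left outside the first column. -/
noncomputable def NOCab (n : ℕ) : Finset (Σ _ : OfSize n, ℕ × ℕ) :=
  Finset.univ.sigma fun T => {c ∈ T.1.shape.cells | T.1.IsNOCab c}

/-- The generating polynomial `T_n(a,b)` of tree-like tableaux of size `n`, evaluated at `a, b`. -/
noncomputable def genPoly {R : Type*} [CommRing R] (n : ℕ) (a b : R) : R :=
  ∑ T : OfSize n, weight a b T.1

end TreeLikeTableau

namespace TreeLikeTableau

/-! Write D (`true`) for a horizontal and E (`false`) for a vertical step of the southeast border,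
read from bottom left to top right. Every column but the first, and every row but the first,
accounts for exactly one non-root point, so rows plus columns equals size plus one. The border of a
tableau of size n thus has n + 1 steps; it starts with D and ends with E, and its interior is an
arbitrary word of length n - 1.

Let ⟨w⟩ be the total weight of the tableaux with border interior w. A factor DE is a corner outside
the first row and column. It is either empty, or pointed with nothing above, or pointed with nothing
to its left. Removing the cell, its column or its row respectively gives ⟨uDEv⟩ = ⟨uEDv⟩ + ⟨uEv⟩ +
⟨uDv⟩ (`wordWeight_corner`). With ⟨Ew⟩ = b⟨w⟩ and ⟨wD⟩ = a⟨w⟩ this is a matrix ansatz: DE = ED + D +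
E yields D(D+E)^n = (D+E)^n(D+n), hence the product formula (`sum_wordWeight`).

For a corner counted by the theorem, the only point of its row is in the first column and the only
point of its column is in the first row. Deleting both lines costs a factor ab and leaves an
arbitrary tableau with interior uv (`sum_free_cells`). There are n - 2 positions for DE in a word of
length n - 1, and for each of them uv runs once through all words of length n - 3
(`sum_innerCorners`). Each position therefore contributes ab times the generating polynomial of size
n - 2. -/

/-! ### Tableaux on arbitrary sets of cells -/

/-- `S` is the set of points of a tree-like tableau drawn on the set `C` of cells, where `C` need
not be the set of cells of a Young diagram. -/
structure IsTableau (C S : Finset (ℕ × ℕ)) : Prop where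
  subset : S ⊆ C
  root : ((0, 0) : ℕ × ℕ) ∈ S
  parent : ∀ c ∈ S, c ≠ (0, 0) →
    Xor (∃ i < c.1, (i, c.2) ∈ S) (∃ j < c.2, (c.1, j) ∈ S)
  row : ∀ c ∈ C, ∃ j, (c.1, j) ∈ S
  col : ∀ c ∈ C, ∃ i, (i, c.2) ∈ S

/-- The weight of a set of points. -/
def pointWeight {R : Type*} [CommRing R] (a b : R) (S : Finset (ℕ × ℕ)) : R :=
  a ^ {c ∈ S | c.1 = 0 ∧ c ≠ (0, 0)}.card * b ^ {c ∈ S | c.2 = 0 ∧ c ≠ (0, 0)}.card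

open Classical in
/-- The tree-like tableaux drawn on the set `C` of cells. -/
noncomputable def tableaux (C : Finset (ℕ × ℕ)) : Finset (Finset (ℕ × ℕ)) :=
  {S ∈ C.powerset | IsTableau C S}

theorem mem_tableaux {C S : Finset (ℕ × ℕ)} : S ∈ tableaux C ↔ IsTableau C S := by
  simp only [tableaux, Finset.mem_filter, Finset.mem_powerset, and_iff_right_iff_imp]
  exact fun h => h.subset

/-- The total weight of the tree-like tableaux drawn on `C`. -/
noncomputable def totalWeight {R : Type*} [CommRing R] (a b : R) (C : Finset (ℕ × ℕ)) : R :=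
  ∑ S ∈ tableaux C, pointWeight a b S

theorem pointWeight_insert {R : Type*} [CommRing R] (a b : R) {S : Finset (ℕ × ℕ)} {i j : ℕ}
    (h : (i, j) ∉ S) (h0 : (i, j) ≠ (0, 0)) :
    pointWeight a b (insert (i, j) S) =
      (if i = 0 then a else 1) * (if j = 0 then b else 1) * pointWeight a b S := by
  unfold pointWeight
  rw [Finset.filter_insert, Finset.filter_insert]
  have h1 : (i, j) ∉ {c ∈ S | c.1 = 0 ∧ c ≠ (0, 0)} := fun h' => h (Finset.mem_filter.1 h').1
  have h2 : (i, j) ∉ {c ∈ S | c.2 = 0 ∧ c ≠ (0, 0)} := fun h' => h (Finset.mem_filter.1 h').1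
  by_cases hi : i = 0 <;> by_cases hj : j = 0 <;> simp_all [Finset.card_insert_of_notMem] <;> ring

/-! ### Removing and inserting the column of an extremal point -/

/-- The cell `(i, j)` of `C` has no cell of `C` below it or to its right. -/
structure IsExtremal (C : Finset (ℕ × ℕ)) (i j : ℕ) : Prop where
  mem : (i, j) ∈ C
  down : ∀ i', i < i' → (i', j) ∉ C
  right : ∀ j', j < j' → (i, j') ∉ C

/-- With nothing above it and no cell below it, the point is alone in its column, so it has its
parent to the left; that parent keeps the row pointed. No cell lies to the right of the point, hence
it is nobody else's witness in the parent condition. -/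
theorem IsTableau.erase_col {C S : Finset (ℕ × ℕ)} {i j : ℕ} (hC : IsExtremal C i j)
    (hj : j ≠ 0) (hS : IsTableau C S) (hc : (i, j) ∈ S) (ha : ∀ i' < i, (i', j) ∉ S) :
    IsTableau {c ∈ C | c.2 ≠ j} (S.erase (i, j)) := by
  have hcol : ∀ i', (i', j) ∈ S → i' = i := by
    intro i' h
    rcases lt_trichotomy i' i with h1 | h1 | h1
    · exact absurd h (ha _ h1)
    · exact h1
    · exact absurd (hS.subset h) (hC.down _ h1)
  have hleft : ∃ j' < j, (i, j') ∈ S := by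
    have := hS.parent _ hc (by simp [hj])
    rcases this with h | h
    · obtain ⟨⟨i', h1, h2⟩, -⟩ := h
      exact absurd h2 (ha _ h1)
    · exact h.1
  have hr := hC.right
  obtain ⟨h1, h2, h3, h4, h5⟩ := hS
  refine ⟨?_, ?_, ?_, ?_, ?_⟩
  · intro c hc'
    grind
  · grind
  · rintro ⟨x, y⟩ hxy h0
    have hxy' := Finset.mem_erase.1 hxy
    have hy : y ≠ j := by grind
    have := h3 _ hxy'.2 h0
    have e1 : (∃ i' < x, (i', y) ∈ S.erase (i, j)) ↔ ∃ i' < x, (i', y) ∈ S := by grind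
    have e2 : (∃ j' < y, (x, j') ∈ S.erase (i, j)) ↔ ∃ j' < y, (x, j') ∈ S := by
      constructor
      · grind
      · rintro ⟨j', hj', hm⟩
        refine ⟨j', hj', Finset.mem_erase.2 ⟨?_, hm⟩⟩
        rintro h
        simp only [Prod.mk.injEq] at h
        obtain ⟨rfl, rfl⟩ := h
        exact hr _ hj' (h1 hxy'.2)
    simpa only [e1, e2] using this
  · rintro ⟨x, y⟩ hxy
    obtain ⟨y', hy'⟩ := h4 _ (Finset.mem_filter.1 hxy).1
    by_cases h : (x, y') = (i, j)
    · obtain ⟨j', hj', hm⟩ := hleft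
      exact ⟨j', by grind⟩
    · exact ⟨y', by grind⟩
  · rintro ⟨x, y⟩ hxy
    obtain ⟨x', hx'⟩ := h5 _ (Finset.mem_filter.1 hxy).1
    exact ⟨x', by grind⟩

theorem IsTableau.insert_col {C S : Finset (ℕ × ℕ)} {i j : ℕ} (hC : IsExtremal C i j)
    (hj : j ≠ 0) (h0 : ∀ x y, (x, y) ∈ C → (x, 0) ∈ C) (hS : IsTableau {c ∈ C | c.2 ≠ j} S) :
    IsTableau C (insert (i, j) S) := by
  obtain ⟨hm, hd, hr⟩ := hC
  obtain ⟨h1, h2, h3, h4, h5⟩ := hS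
  have hcol : ∀ i', (i', j) ∉ S := fun i' h => (Finset.mem_filter.1 (h1 h)).2 rfl
  have hSC : S ⊆ C := fun c h => (Finset.mem_filter.1 (h1 h)).1
  -- Since `j ≠ 0`, the row survives the removal of the column through `(i, 0)`. It therefore has a
  -- point, which serves as left parent of the inserted one.
  obtain ⟨j₀, hj₀⟩ := h4 (i, 0) (by have := h0 _ _ hm; grind)
  have hj₀' : j₀ < j := by
    rcases lt_trichotomy j₀ j with h | h | h
    · exact h
    · exact absurd (h ▸ hj₀) (hcol _)
    · exact absurd (hSC hj₀) (hr _ h)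
  refine ⟨?_, ?_, ?_, ?_, ?_⟩
  · intro c hc'
    grind
  · grind
  · rintro ⟨x, y⟩ hxy h0
    rcases Finset.mem_insert.1 hxy with h | h
    · simp only [Prod.mk.injEq] at h
      obtain ⟨rfl, rfl⟩ := h
      refine Or.inr ⟨⟨j₀, hj₀', Finset.mem_insert_of_mem hj₀⟩, ?_⟩
      rintro ⟨i', hi', hm'⟩
      grind
    · have hy : y ≠ j := fun e => hcol x (e ▸ h)
      have := h3 _ h h0
      have e1 : (∃ i' < x, (i', y) ∈ insert (i, j) S) ↔ ∃ i' < x, (i', y) ∈ S := by grind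
      have e2 : (∃ j' < y, (x, j') ∈ insert (i, j) S) ↔ ∃ j' < y, (x, j') ∈ S := by
        constructor
        · rintro ⟨j', hj', hm'⟩
          rcases Finset.mem_insert.1 hm' with h' | h'
          · simp only [Prod.mk.injEq] at h'
            obtain ⟨rfl, rfl⟩ := h'
            exact absurd (hSC h) (hr _ hj')
          · exact ⟨j', hj', h'⟩
        · grind
      simpa only [e1, e2] using this
  · rintro ⟨x, y⟩ hxy
    by_cases h : y = j
    · subst h
      by_cases hx : x = i
      · exact ⟨y, by grind⟩
      · obtain ⟨j', h'⟩ := h4 (x, 0) (by have := h0 _ _ hxy; grind)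
        exact ⟨j', by grind⟩
    · obtain ⟨j', h'⟩ := h4 (x, y) (by grind)
      exact ⟨j', by grind⟩
  · rintro ⟨x, y⟩ hxy
    by_cases h : y = j
    · exact ⟨i, by grind⟩
    · obtain ⟨i', h'⟩ := h5 (x, y) (by grind)
      exact ⟨i', by grind⟩

/-! ### Reflection, exchanging `a` and `b` -/

/-- Reflection of a set of cells in the main diagonal. -/
def flip (C : Finset (ℕ × ℕ)) : Finset (ℕ × ℕ) := C.map (Equiv.prodComm ℕ ℕ).toEmbedding

@[simp] theorem mem_flip {C : Finset (ℕ × ℕ)} {i j : ℕ} : (i, j) ∈ flip C ↔ (j, i) ∈ C := by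
  simp [flip]

@[simp] theorem flip_flip (C : Finset (ℕ × ℕ)) : flip (flip C) = C := by
  ext ⟨i, j⟩; simp

theorem IsTableau.reflect {C S : Finset (ℕ × ℕ)} (h : IsTableau C S) :
    IsTableau (flip C) (flip S) := by
  obtain ⟨h1, h2, h3, h4, h5⟩ := h
  refine ⟨?_, by simpa using h2, ?_, ?_, ?_⟩
  · rintro ⟨i, j⟩ h
    exact mem_flip.2 (h1 (mem_flip.1 h))
  · rintro ⟨i, j⟩ h h0
    have := h3 (j, i) (mem_flip.1 h) (by simpa [and_comm] using h0)
    simp only [mem_flip]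
    exact (xor_comm _ _).mp this
  · rintro ⟨i, j⟩ h
    simpa using h5 (j, i) (mem_flip.1 h)
  · rintro ⟨i, j⟩ h
    simpa using h4 (j, i) (mem_flip.1 h)

@[simp] theorem isTableau_flip {C S : Finset (ℕ × ℕ)} :
    IsTableau (flip C) (flip S) ↔ IsTableau C S :=
  ⟨fun h => by simpa using h.reflect, fun h => h.reflect⟩

theorem pointWeight_flip {R : Type*} [CommRing R] (a b : R) (S : Finset (ℕ × ℕ)) :
    pointWeight a b (flip S) = pointWeight b a S := by
  unfold pointWeight flip
  rw [Finset.filter_map, Finset.filter_map, Finset.card_map, Finset.card_map, mul_comm]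
  congr 3 <;> (ext ⟨i, j⟩; rw [Finset.mem_filter, Finset.mem_filter]; simp [and_comm])

theorem sum_flip {R : Type*} [CommRing R] (a b : R) (C : Finset (ℕ × ℕ))
    (p : Finset (ℕ × ℕ) → Prop) [DecidablePred p] [DecidablePred fun S => p (flip S)] :
    ∑ S ∈ tableaux (flip C) with p S, pointWeight a b S =
      ∑ S ∈ tableaux C with p (flip S), pointWeight b a S := by
  refine Finset.sum_bij' (fun S _ => flip S) (fun S _ => flip S) ?_ ?_ ?_ ?_ ?_
  · intro S hS
    simp only [Finset.mem_filter, mem_tableaux, flip_flip] at hS ⊢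
    exact ⟨by simpa using hS.1.reflect, hS.2⟩
  · intro S hS
    simp only [Finset.mem_filter, mem_tableaux] at hS ⊢
    exact ⟨hS.1.reflect, hS.2⟩
  · intro S _; simp
  · intro S _; simp
  · intro S _; rw [pointWeight_flip]

theorem totalWeight_flip {R : Type*} [CommRing R] (a b : R) (C : Finset (ℕ × ℕ)) :
    totalWeight a b (flip C) = totalWeight b a C := by
  simpa [totalWeight] using sum_flip a b C (fun _ => True)

theorem isExtremal_flip {C : Finset (ℕ × ℕ)} {i j : ℕ} :
    IsExtremal (flip C) j i ↔ IsExtremal C i j := by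
  constructor <;> rintro ⟨h1, h2, h3⟩ <;> exact ⟨by simpa using h1, by simpa using h3, by simpa using h2⟩

/-! ### Recursion for the total weight at an extremal cell -/

open Classical in
/-- The tableaux in which an extremal cell is pointed and has no point above it correspond to
those on the set of cells outside its column. -/
theorem sum_pointed_col {R : Type*} [CommRing R] (a b : R) {C : Finset (ℕ × ℕ)} {i j : ℕ}
    (hC : IsExtremal C i j) (hj : j ≠ 0) (h0 : ∀ x y, (x, y) ∈ C → (x, 0) ∈ C) :
    ∑ S ∈ tableaux C with (i, j) ∈ S ∧ ∀ i' < i, (i', j) ∉ S, pointWeight a b S =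
      (if i = 0 then a else 1) * totalWeight a b {c ∈ C | c.2 ≠ j} := by
  have hnot : ∀ S, IsTableau {c ∈ C | c.2 ≠ j} S → ∀ i', (i', j) ∉ S :=
    fun S hS i' h => (Finset.mem_filter.1 (hS.subset h)).2 rfl
  rw [totalWeight, Finset.mul_sum]
  refine Finset.sum_bij' (fun S _ => S.erase (i, j)) (fun S _ => insert (i, j) S) ?_ ?_ ?_ ?_ ?_
  · intro S hS
    simp only [Finset.mem_filter, mem_tableaux] at hS ⊢
    exact hS.1.erase_col hC hj hS.2.1 hS.2.2
  · intro S hS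
    simp only [Finset.mem_filter, mem_tableaux] at hS ⊢
    have := hnot S hS
    exact ⟨hS.insert_col hC hj h0, by grind⟩
  · intro S hS
    simp only [Finset.mem_filter, mem_tableaux] at hS
    exact Finset.insert_erase hS.2.1
  · intro S hS
    exact Finset.erase_insert (hnot S (mem_tableaux.1 hS) i)
  · intro S hS
    simp only [Finset.mem_filter, mem_tableaux] at hS
    conv_lhs => rw [← Finset.insert_erase hS.2.1]
    rw [pointWeight_insert _ _ (by simp) (by simp [hj]), if_neg hj, mul_one]

open Classical in
/-- The tableaux in which an extremal cell is pointed and has no point to its left correspond to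
those on the set of cells outside its row. -/
theorem sum_pointed_row {R : Type*} [CommRing R] (a b : R) {C : Finset (ℕ × ℕ)} {i j : ℕ}
    (hC : IsExtremal C i j) (hi : i ≠ 0) (h0 : ∀ x y, (x, y) ∈ C → (0, y) ∈ C) :
    ∑ S ∈ tableaux C with (i, j) ∈ S ∧ ∀ j' < j, (i, j') ∉ S, pointWeight a b S =
      (if j = 0 then b else 1) * totalWeight a b {c ∈ C | c.1 ≠ i} := by
  have h := sum_pointed_col b a (isExtremal_flip.2 hC) hi
    (by simpa using fun x y h => h0 y x h)
  rw [sum_flip] at h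
  simp only [mem_flip] at h
  rw [h, ← totalWeight_flip]
  congr 2
  ext ⟨x, y⟩
  simp

/-- The row and the column of the erased cell remain represented by their cells in the first column
and the first row, so the conditions that they be pointed are unchanged. -/
theorem isTableau_erase_iff {C S : Finset (ℕ × ℕ)} {i j : ℕ} (hi : i ≠ 0) (hj : j ≠ 0) (h0 : ∀ x y, (x, y) ∈ C → (x, 0) ∈ C ∧ (0, y) ∈ C) :
    IsTableau (C.erase (i, j)) S ↔ IsTableau C S ∧ (i, j) ∉ S := by
  constructor
  · rintro ⟨h1, h2, h3, h4, h5⟩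
    refine ⟨⟨h1.trans (Finset.erase_subset _ _), h2, h3, ?_, ?_⟩, fun h => by simpa using h1 h⟩
    · rintro ⟨x, y⟩ h
      exact h4 (x, 0) (by have := h0 _ _ h; grind)
    · rintro ⟨x, y⟩ h
      exact h5 (0, y) (by have := h0 _ _ h; grind)
  · rintro ⟨⟨h1, h2, h3, h4, h5⟩, h⟩
    exact ⟨Finset.subset_erase.2 ⟨h1, h⟩, h2, h3, fun c hc => h4 c (Finset.mem_of_mem_erase hc),
      fun c hc => h5 c (Finset.mem_of_mem_erase hc)⟩

/-- The three terms correspond to the corner being empty, pointed without a point to its left, and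
pointed without a point above it. The exclusive choice of a parent makes these cases disjoint and
exhaustive. -/
theorem totalWeight_corner {R : Type*} [CommRing R] (a b : R) {C : Finset (ℕ × ℕ)} {i j : ℕ}
    (hC : IsExtremal C i j) (hi : i ≠ 0) (hj : j ≠ 0)
    (h0 : ∀ x y, (x, y) ∈ C → (x, 0) ∈ C ∧ (0, y) ∈ C) :
    totalWeight a b C = totalWeight a b (C.erase (i, j)) + totalWeight a b {c ∈ C | c.1 ≠ i} +
      totalWeight a b {c ∈ C | c.2 ≠ j} := by
  classical
  have e1 : tableaux (C.erase (i, j)) = {S ∈ tableaux C | (i, j) ∉ S} := by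
    ext S
    rw [Finset.mem_filter, mem_tableaux, mem_tableaux, isTableau_erase_iff hi hj h0]
  have e2 := sum_pointed_col a b hC hj (fun x y h => (h0 x y h).1)
  have e3 := sum_pointed_row a b hC hi (fun x y h => (h0 x y h).2)
  rw [if_neg hi, one_mul] at e2
  rw [if_neg hj, one_mul] at e3
  rw [← e2, ← e3]
  unfold totalWeight
  rw [e1, ← Finset.sum_filter_not_add_sum_filter (tableaux C) (fun S => (i, j) ∈ S), add_assoc]
  congr 1
  rw [← Finset.sum_filter_not_add_sum_filter {S ∈ tableaux C | (i, j) ∈ S}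
    (fun S => ∀ i' < i, (i', j) ∉ S), Finset.filter_filter, Finset.filter_filter]
  congr 1
  -- For a pointed corner other than the root, having a point above is the same as having none to
  -- the left.
  refine Finset.sum_congr (Finset.filter_congr fun S hS => ?_) fun _ _ => rfl
  refine and_congr_right fun hm => ?_
  have := (mem_tableaux.1 hS).parent _ hm (by simp [hi])
  have := xor_iff_iff_not.1 this
  simp only at this
  push Not at this ⊢
  exact this

/-- An extremal cell of the first row is alone in its column, so it must be pointed and only one
case of the recursion remains. -/
theorem totalWeight_corner_top {R : Type*} [CommRing R] (a b : R) {C : Finset (ℕ × ℕ)} {j : ℕ}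
    (hC : IsExtremal C 0 j) (hj : j ≠ 0) (h0 : ∀ x y, (x, y) ∈ C → (x, 0) ∈ C) :
    totalWeight a b C = a * totalWeight a b {c ∈ C | c.2 ≠ j} := by
  classical
  have e := sum_pointed_col a b hC hj h0
  rw [if_pos rfl] at e
  rw [← e, totalWeight, Finset.filter_true_of_mem]
  intro S hS
  have hS := mem_tableaux.1 hS
  obtain ⟨i, hi⟩ := hS.col _ hC.mem
  rcases Nat.eq_zero_or_pos i with rfl | h
  · exact ⟨hi, by simp⟩
  · exact absurd (hS.subset hi) (hC.down _ h)

theorem totalWeight_corner_left {R : Type*} [CommRing R] (a b : R) {C : Finset (ℕ × ℕ)} {i : ℕ}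
    (hC : IsExtremal C i 0) (hi : i ≠ 0) (h0 : ∀ x y, (x, y) ∈ C → (0, y) ∈ C) :
    totalWeight a b C = b * totalWeight a b {c ∈ C | c.1 ≠ i} := by
  rw [← totalWeight_flip, totalWeight_corner_top b a (isExtremal_flip.2 hC) hi
    (by simpa using fun x y h => h0 y x h), ← totalWeight_flip]
  congr 2
  ext ⟨x, y⟩
  simp

/-! ### Free corners: deleting a row and a column at once -/

/-- The condition on a set of points saying that the extremal cell `(i, j)` is unpointed, with no
points above it outside the first row and none to its left outside the first column. -/
def IsFree (S : Finset (ℕ × ℕ)) (i j : ℕ) : Prop :=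
  (i, j) ∉ S ∧ (∀ i' < i, (i', j) ∈ S → i' = 0) ∧ (∀ j' < j, (i, j') ∈ S → j' = 0)

/-- The row and the column of a free corner must be pointed, which is possible only at `(i, 0)` and
`(0, j)`. No other point is lost when both lines are removed. -/
theorem IsTableau.erase_free {C S : Finset (ℕ × ℕ)} {i j : ℕ} (hC : IsExtremal C i j)
    (hi : i ≠ 0) (hj : j ≠ 0) (hS : IsTableau C S) (hf : IsFree S i j) :
    (i, 0) ∈ S ∧ (0, j) ∈ S ∧
      IsTableau {c ∈ C | c.1 ≠ i ∧ c.2 ≠ j} ((S.erase (i, 0)).erase (0, j)) := by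
  obtain ⟨hm, hd, hr⟩ := hC
  obtain ⟨h1, h2, h3, h4, h5⟩ := hS
  obtain ⟨f1, f2, f3⟩ := hf
  have hcol : ∀ x, (x, j) ∈ S → x = 0 := by
    intro x hx
    rcases lt_trichotomy x i with h | rfl | h
    · exact f2 _ h hx
    · exact absurd hx f1
    · exact absurd (h1 hx) (hd _ h)
  have hrow : ∀ y, (i, y) ∈ S → y = 0 := by
    intro y hy
    rcases lt_trichotomy y j with h | rfl | h
    · exact f3 _ h hy
    · exact absurd hy f1
    · exact absurd (h1 hy) (hr _ h)
  have hi0 : (i, 0) ∈ S := by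
    obtain ⟨y, hy⟩ := h4 _ hm
    exact hrow y hy ▸ hy
  have hj0 : (0, j) ∈ S := by
    obtain ⟨x, hx⟩ := h5 _ hm
    exact hcol x hx ▸ hx
  have hmem : ∀ x y, (x, y) ∈ (S.erase (i, 0)).erase (0, j) ↔ (x, y) ∈ S ∧ x ≠ i ∧ y ≠ j := by
    intro x y
    grind
  refine ⟨hi0, hj0, ?_, ?_, ?_, ?_, ?_⟩
  · rintro ⟨x, y⟩ h
    have := (hmem _ _).1 h
    simp only [Finset.mem_filter]
    exact ⟨h1 this.1, this.2⟩
  · grind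
  · rintro ⟨x, y⟩ h hne
    obtain ⟨hs, hx, hy⟩ := (hmem _ _).1 h
    have := h3 _ hs hne
    simp only [hmem]
    have e1 : (∃ x' < x, (x', y) ∈ S ∧ x' ≠ i ∧ y ≠ j) ↔ ∃ x' < x, (x', y) ∈ S := by
      constructor
      · grind
      · rintro ⟨x', h', h''⟩
        -- If the witness lies in the deleted row it is `(i, 0)`, so the cell is in the first column
        -- and the root can replace it; the analogous swap works for columns.
        by_cases hx' : x' = i
        · subst hx'
          obtain rfl := hrow _ h''
          exact ⟨0, by omega, h2, hi.symm, hy⟩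
        · exact ⟨x', h', h'', hx', hy⟩
    have e2 : (∃ y' < y, (x, y') ∈ S ∧ x ≠ i ∧ y' ≠ j) ↔ ∃ y' < y, (x, y') ∈ S := by
      constructor
      · grind
      · rintro ⟨y', h', h''⟩
        by_cases hy' : y' = j
        · subst hy'
          obtain rfl := hcol _ h''
          exact ⟨0, by omega, h2, hx, hj.symm⟩
        · exact ⟨y', h', h'', hx, hy'⟩
    simpa only [e1, e2] using this
  · rintro ⟨x, y⟩ h
    simp only [Finset.mem_filter] at h
    obtain ⟨y', hy'⟩ := h4 _ h.1
    simp only [hmem]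
    by_cases hj' : y' = j
    · subst hj'
      obtain rfl := hcol _ hy'
      exact ⟨0, h2, h.2.1, hj.symm⟩
    · exact ⟨y', hy', h.2.1, hj'⟩
  · rintro ⟨x, y⟩ h
    simp only [Finset.mem_filter] at h
    obtain ⟨x', hx'⟩ := h5 _ h.1
    simp only [hmem]
    by_cases hi' : x' = i
    · subst hi'
      obtain rfl := hrow _ hx'
      exact ⟨0, h2, hi.symm, h.2.2⟩
    · exact ⟨x', hx', hi', h.2.2⟩

theorem IsTableau.insert_free {C S : Finset (ℕ × ℕ)} {i j : ℕ} (hC : IsExtremal C i j)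
    (hi : i ≠ 0) (hj : j ≠ 0) (h0 : ∀ x y, (x, y) ∈ C → (x, 0) ∈ C ∧ (0, y) ∈ C)
    (hS : IsTableau {c ∈ C | c.1 ≠ i ∧ c.2 ≠ j} S) :
    IsTableau C (insert (i, 0) (insert (0, j) S)) ∧
      IsFree (insert (i, 0) (insert (0, j) S)) i j := by
  obtain ⟨h1, h2, h3, h4, h5⟩ := hS
  have hn : ∀ x y, (x, y) ∈ S → (x, y) ∈ C ∧ x ≠ i ∧ y ≠ j := by
    intro x y h
    simpa using h1 h
  have hmem : ∀ x y, (x, y) ∈ insert (i, 0) (insert (0, j) S) ↔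
      (x = i ∧ y = 0) ∨ (x = 0 ∧ y = j) ∨ (x, y) ∈ S := by
    intro x y
    simp
  refine ⟨⟨?_, by simp [h2], ?_, ?_, ?_⟩, ?_⟩
  · rintro ⟨x, y⟩ h
    have := h0 _ _ hC.mem
    rcases (hmem _ _).1 h with ⟨rfl, rfl⟩ | ⟨rfl, rfl⟩ | h
    · exact this.1
    · exact this.2
    · exact (hn _ _ h).1
  · rintro ⟨x, y⟩ h hne
    simp only [hmem]
    rcases (hmem _ _).1 h with ⟨rfl, rfl⟩ | ⟨rfl, rfl⟩ | h
    · exact Or.inl ⟨⟨0, by omega, by simp [h2]⟩, by simp⟩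
    · exact Or.inr ⟨⟨0, by omega, by simp [h2]⟩, by simp⟩
    · have hxy := hn _ _ h
      have := h3 _ h hne
      have e1 : (∃ x' < x, x' = i ∧ y = 0 ∨ x' = 0 ∧ y = j ∨ (x', y) ∈ S) ↔
          ∃ x' < x, (x', y) ∈ S := by
        constructor
        · rintro ⟨x', hx', ⟨rfl, rfl⟩ | ⟨rfl, rfl⟩ | h'⟩
          · exact ⟨0, by omega, h2⟩
          · exact absurd rfl hxy.2.2
          · exact ⟨x', hx', h'⟩
        · grind
      have e2 : (∃ y' < y, x = i ∧ y' = 0 ∨ x = 0 ∧ y' = j ∨ (x, y') ∈ S) ↔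
          ∃ y' < y, (x, y') ∈ S := by
        constructor
        · rintro ⟨y', hy', ⟨rfl, rfl⟩ | ⟨rfl, rfl⟩ | h'⟩
          · exact absurd rfl hxy.2.1
          · exact ⟨0, by omega, h2⟩
          · exact ⟨y', hy', h'⟩
        · grind
      simpa only [e1, e2] using this
  · rintro ⟨x, y⟩ h
    simp only [hmem]
    by_cases hx : x = i
    · exact ⟨0, Or.inl ⟨hx, rfl⟩⟩
    · obtain ⟨y', hy'⟩ := h4 (x, 0) (by simpa using ⟨(h0 _ _ h).1, hx, hj.symm⟩)
      exact ⟨y', Or.inr (Or.inr hy')⟩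
  · rintro ⟨x, y⟩ h
    simp only [hmem]
    by_cases hy : y = j
    · exact ⟨0, Or.inr (Or.inl ⟨rfl, hy⟩)⟩
    · obtain ⟨x', hx'⟩ := h5 (0, y) (by simpa using ⟨(h0 _ _ h).2, hi.symm, hy⟩)
      exact ⟨x', Or.inr (Or.inr hx')⟩
  · simp only [IsFree, hmem]
    grind

open Classical in
theorem sum_free {R : Type*} [CommRing R] (a b : R) {C : Finset (ℕ × ℕ)} {i j : ℕ}
    (hC : IsExtremal C i j) (hi : i ≠ 0) (hj : j ≠ 0)
    (h0 : ∀ x y, (x, y) ∈ C → (x, 0) ∈ C ∧ (0, y) ∈ C) :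
    ∑ S ∈ tableaux C with IsFree S i j, pointWeight a b S =
      a * b * totalWeight a b {c ∈ C | c.1 ≠ i ∧ c.2 ≠ j} := by
  have hni : ∀ S, IsTableau {c ∈ C | c.1 ≠ i ∧ c.2 ≠ j} S → (i, 0) ∉ insert (0, j) S := by
    intro S hS h
    have := @hS.subset (i, 0)
    simp_all
  have hnj : ∀ S, IsTableau {c ∈ C | c.1 ≠ i ∧ c.2 ≠ j} S → (0, j) ∉ S := by
    intro S hS h
    have := @hS.subset (0, j)
    simp_all
  have hinv : ∀ S : Finset (ℕ × ℕ), (i, 0) ∈ S → (0, j) ∈ S →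
      insert (i, 0) (insert (0, j) ((S.erase (i, 0)).erase (0, j))) = S := by
    intro S h1 h2
    rw [Finset.insert_erase, Finset.insert_erase h1]
    simp [h2, hj]
  rw [totalWeight, Finset.mul_sum]
  refine Finset.sum_bij' (fun S _ => (S.erase (i, 0)).erase (0, j))
    (fun S _ => insert (i, 0) (insert (0, j) S)) ?_ ?_ ?_ ?_ ?_
  · intro S hS
    simp only [Finset.mem_filter, mem_tableaux] at hS ⊢
    exact (hS.1.erase_free hC hi hj hS.2).2.2
  · intro S hS
    simp only [Finset.mem_filter, mem_tableaux] at hS ⊢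
    exact hS.insert_free hC hi hj h0
  · intro S hS
    simp only [Finset.mem_filter, mem_tableaux] at hS
    have := hS.1.erase_free hC hi hj hS.2
    exact hinv S this.1 this.2.1
  · intro S hS
    have hS := mem_tableaux.1 hS
    rw [Finset.erase_insert (hni S hS), Finset.erase_insert (hnj S hS)]
  · intro S hS
    simp only [Finset.mem_filter, mem_tableaux] at hS
    obtain ⟨h1, h2, h3⟩ := hS.1.erase_free hC hi hj hS.2
    conv_lhs => rw [← hinv S h1 h2]
    rw [pointWeight_insert _ _ (hni _ h3) (by simp [hi]),
      pointWeight_insert _ _ (hnj _ h3) (by simp [hj])]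
    simp only [hi, hj, if_true, if_false]
    ring

/-! ### Closing the gaps left by deleted rows and columns -/

/-- The injection of cells induced by strictly monotone relabellings of rows and columns. -/
def relabel {f g : ℕ → ℕ} (hf : StrictMono f) (hg : StrictMono g) : ℕ × ℕ ↪ ℕ × ℕ :=
  ⟨Prod.map f g, hf.injective.prodMap hg.injective⟩

/-- The axioms compare positions only within rows and columns, so strictly increasing relabellings
preserve them; fixing `0` keeps the root in place. -/
theorem isTableau_relabel {f g : ℕ → ℕ} (hf : StrictMono f) (hg : StrictMono g) (f0 : f 0 = 0)
    (g0 : g 0 = 0) {C S : Finset (ℕ × ℕ)} :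
    IsTableau (C.map (relabel hf hg)) (S.map (relabel hf hg)) ↔ IsTableau C S := by
  have hm : ∀ S : Finset (ℕ × ℕ), ∀ x y, (x, y) ∈ S.map (relabel hf hg) ↔
      ∃ i j, (i, j) ∈ S ∧ f i = x ∧ g j = y := by
    intro S x y
    simp [relabel]
  have hm' : ∀ S : Finset (ℕ × ℕ), ∀ x y, (f x, g y) ∈ S.map (relabel hf hg) ↔ (x, y) ∈ S := by
    intro S x y
    rw [hm]
    simp [hf.injective.eq_iff, hg.injective.eq_iff]
  have hp : ∀ i j, Xor (∃ x < f i, (x, g j) ∈ S.map (relabel hf hg))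
      (∃ y < g j, (f i, y) ∈ S.map (relabel hf hg)) ↔
      Xor (∃ x < i, (x, j) ∈ S) (∃ y < j, (i, y) ∈ S) := by
    intro i j
    have e1 : (∃ x < f i, (x, g j) ∈ S.map (relabel hf hg)) ↔ ∃ x < i, (x, j) ∈ S := by
      constructor
      · rintro ⟨x, hx, h⟩
        obtain ⟨x, j', h', rfl, hj⟩ := (hm _ _ _).1 h
        exact ⟨x, hf.lt_iff_lt.1 hx, hg.injective hj ▸ h'⟩
      · rintro ⟨x, hx, h⟩
        exact ⟨f x, hf hx, (hm' _ _ _).2 h⟩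
    have e2 : (∃ y < g j, (f i, y) ∈ S.map (relabel hf hg)) ↔ ∃ y < j, (i, y) ∈ S := by
      constructor
      · rintro ⟨y, hy, h⟩
        obtain ⟨i', y, h', hi, rfl⟩ := (hm _ _ _).1 h
        exact ⟨y, hg.lt_iff_lt.1 hy, hf.injective hi ▸ h'⟩
      · rintro ⟨y, hy, h⟩
        exact ⟨g y, hg hy, (hm' _ _ _).2 h⟩
    rw [e1, e2]
  have h00 : ∀ i j, (f i, g j) = (0, 0) ↔ (i, j) = (0, 0) := by
    intro i j
    have hi := hf.injective.eq_iff (a := i) (b := 0)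
    have hj := hg.injective.eq_iff (a := j) (b := 0)
    rw [f0] at hi
    rw [g0] at hj
    rw [Prod.mk.injEq, Prod.mk.injEq, hi, hj]
  constructor
  · rintro ⟨h1, h2, h3, h4, h5⟩
    refine ⟨Finset.map_subset_map.1 h1, ?_, ?_, ?_, ?_⟩
    · rwa [← hm', f0, g0]
    · rintro ⟨i, j⟩ h hne
      exact (hp i j).1 (h3 (f i, g j) ((hm' _ _ _).2 h) (by rwa [Ne, h00]))
    · rintro ⟨i, j⟩ h
      obtain ⟨y, hy⟩ := h4 (f i, g j) ((hm' _ _ _).2 h)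
      obtain ⟨i', j', h', hi, -⟩ := (hm _ _ _).1 hy
      exact ⟨j', hf.injective hi ▸ h'⟩
    · rintro ⟨i, j⟩ h
      obtain ⟨y, hy⟩ := h5 (f i, g j) ((hm' _ _ _).2 h)
      obtain ⟨i', j', h', -, hj⟩ := (hm _ _ _).1 hy
      exact ⟨i', hg.injective hj ▸ h'⟩
  · rintro ⟨h1, h2, h3, h4, h5⟩
    refine ⟨Finset.map_subset_map.2 h1, ?_, ?_, ?_, ?_⟩
    · exact (hm _ _ _).2 ⟨0, 0, h2, f0, g0⟩
    · rintro ⟨x, y⟩ h hne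
      obtain ⟨i, j, hs, rfl, rfl⟩ := (hm _ _ _).1 h
      exact (hp i j).2 (h3 (i, j) hs (by rwa [Ne, ← h00]))
    · rintro ⟨x, y⟩ h
      obtain ⟨i, j, hs, rfl, rfl⟩ := (hm _ _ _).1 h
      obtain ⟨j', h'⟩ := h4 _ hs
      exact ⟨g j', (hm' _ _ _).2 h'⟩
    · rintro ⟨x, y⟩ h
      obtain ⟨i, j, hs, rfl, rfl⟩ := (hm _ _ _).1 h
      obtain ⟨i', h'⟩ := h5 _ hs
      exact ⟨f i', (hm' _ _ _).2 h'⟩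

theorem totalWeight_relabel {R : Type*} [CommRing R] (a b : R) {f g : ℕ → ℕ} (hf : StrictMono f)
    (hg : StrictMono g) (f0 : f 0 = 0) (g0 : g 0 = 0) (C : Finset (ℕ × ℕ)) :
    totalWeight a b (C.map (relabel hf hg)) = totalWeight a b C := by
  have e : tableaux (C.map (relabel hf hg)) =
      (tableaux C).map ⟨Finset.map (relabel hf hg), Finset.map_injective _⟩ := by
    ext S
    simp only [Finset.mem_map, mem_tableaux, Function.Embedding.coeFn_mk]
    constructor
    · intro h
      obtain ⟨S, -, rfl⟩ := Finset.subset_map_iff.1 h.subset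
      exact ⟨S, (isTableau_relabel hf hg f0 g0).1 h, rfl⟩
    · rintro ⟨S, h, rfl⟩
      exact (isTableau_relabel hf hg f0 g0).2 h
  have hf' : ∀ x, f x = 0 ↔ x = 0 := fun x => by rw [← f0, hf.injective.eq_iff, f0]
  have hg' : ∀ x, g x = 0 ↔ x = 0 := fun x => by rw [← g0, hg.injective.eq_iff, g0]
  unfold totalWeight
  rw [e, Finset.sum_map]
  refine Finset.sum_congr rfl fun S _ => ?_
  unfold pointWeight
  simp only [Function.Embedding.coeFn_mk, Finset.filter_map, Finset.card_map]
  congr 3 <;> (ext ⟨i, j⟩; rw [Finset.mem_filter, Finset.mem_filter]; simp [relabel, hf', hg'])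

/-! ### Border words and their diagrams -/

/-- Words in two letters encode southeast borders read from the bottom left to the top right:
`true` is a horizontal step (a column) and `false` a vertical step (a row). A column and a row
meet in a cell if the letter of the column precedes that of the row. -/
def InShape : List Bool → ℕ → ℕ → Prop
  | [], _, _ => False
  | true :: w, i, 0 => i < w.count false
  | true :: w, i, j + 1 => InShape w i j
  | false :: w, i, j => InShape w i j

@[simp] theorem inShape_nil (i j : ℕ) : ¬ InShape [] i j := id

@[simp] theorem inShape_true_zero (w : List Bool) (i : ℕ) :
    InShape (true :: w) i 0 ↔ i < w.count false := Iff.rfl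

@[simp] theorem inShape_true_succ (w : List Bool) (i j : ℕ) :
    InShape (true :: w) i (j + 1) ↔ InShape w i j := Iff.rfl

@[simp] theorem inShape_false (w : List Bool) (i j : ℕ) :
    InShape (false :: w) i j ↔ InShape w i j := by
  cases j <;> exact Iff.rfl

theorem InShape.lt {w : List Bool} {i j : ℕ} (h : InShape w i j) :
    i < w.count false ∧ j < w.count true := by
  induction w generalizing i j with
  | nil => exact h.elim
  | cons x w ih =>
    cases x
    · have := ih ((inShape_false _ _ _).1 h)
      simp
      omega
    · cases j with
      | zero => simpa using h
      | succ j =>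
        have := ih ((inShape_true_succ _ _ _).1 h)
        simpa using this

theorem InShape.mono {w : List Bool} {i j i' j' : ℕ} (h : InShape w i j) (hi : i' ≤ i)
    (hj : j' ≤ j) : InShape w i' j' := by
  induction w generalizing i j i' j' with
  | nil => exact h.elim
  | cons x w ih =>
    cases x
    · simp only [inShape_false] at h ⊢
      exact ih h hi hj
    · cases j' with
      | zero =>
        cases j with
        | zero => exact lt_of_le_of_lt hi h
        | succ j => exact lt_of_le_of_lt hi (InShape.lt ((inShape_true_succ _ _ _).1 h)).1
      | succ j' =>
        cases j with
        | zero => omega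
        | succ j => exact ih ((inShape_true_succ _ _ _).1 h) hi (by omega)

/-- Columns are numbered in reading order and rows against it. The columns of `v` are therefore
shifted by those of `u`, and the rows of `u` by those of `v`; every column of `u` meets every row of
`v`. -/
theorem inShape_append (u v : List Bool) (i j : ℕ) :
    InShape (u ++ v) i j ↔
      (j < u.count true ∧ (i < v.count false ∨ v.count false ≤ i ∧
        InShape u (i - v.count false) j)) ∨
      (u.count true ≤ j ∧ InShape v i (j - u.count true)) := by
  induction u generalizing j with
  | nil => simp
  | cons x u ih =>
    cases x
    · simpa using ih j
    · cases j with
      | zero =>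
        simp
        omega
      | succ j =>
        simpa using ih j

open Classical in
/-- The cells of the diagram encoded by a word. -/
noncomputable def cells (w : List Bool) : Finset (ℕ × ℕ) :=
  {c ∈ Finset.range (w.count false) ×ˢ Finset.range (w.count true) | InShape w c.1 c.2}

@[simp] theorem mem_cells {w : List Bool} {i j : ℕ} : (i, j) ∈ cells w ↔ InShape w i j := by
  simp only [cells, Finset.mem_filter, Finset.mem_product, Finset.mem_range, and_iff_right_iff_imp]
  exact InShape.lt

/-- The order embedding of `ℕ` in itself whose range omits `k`. -/
def skip (k x : ℕ) : ℕ := if x < k then x else x + 1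

theorem strictMono_skip (k : ℕ) : StrictMono (skip k) := by
  intro x y h
  unfold skip
  split_ifs <;> omega

theorem skip_zero {k : ℕ} (hk : k ≠ 0) : skip k 0 = 0 := by
  simp [skip]
  omega

theorem exists_skip {k y : ℕ} {p : ℕ → Prop} :
    (∃ x, p x ∧ skip k x = y) ↔ y < k ∧ p y ∨ k < y ∧ p (y - 1) := by
  constructor
  · rintro ⟨x, hx, rfl⟩
    unfold skip
    split_ifs with h
    · exact Or.inl ⟨h, hx⟩
    · exact Or.inr ⟨by omega, by simpa using hx⟩
  · rintro (⟨h, hp⟩ | ⟨h, hp⟩)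
    · exact ⟨y, hp, by simp [skip, h]⟩
    · exact ⟨y - 1, hp, by unfold skip; split_ifs <;> omega⟩

theorem mem_relabel {f g : ℕ → ℕ} (hf : StrictMono f) (hg : StrictMono g) {C : Finset (ℕ × ℕ)}
    {x y : ℕ} : (x, y) ∈ C.map (relabel hf hg) ↔ ∃ i, (∃ j, (i, j) ∈ C ∧ g j = y) ∧ f i = x := by
  simp only [relabel, Finset.mem_map, Function.Embedding.coeFn_mk, Prod.exists, Prod.map,
    Prod.mk.injEq]
  grind

/-! ### Deletions at a corner as operations on words -/

section Corner

variable (u v : List Bool)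

theorem inShape_corner (i j : ℕ) : InShape (u ++ true :: false :: v) i j ↔
    (j < u.count true ∧ (i ≤ v.count false ∨ v.count false < i ∧
      InShape u (i - v.count false - 1) j)) ∨ (j = u.count true ∧ i ≤ v.count false) ∨
      (u.count true < j ∧ InShape v i (j - u.count true - 1)) := by
  rw [inShape_append]
  rcases lt_trichotomy j (u.count true) with h | rfl | h
  · simp [h, h.not_ge, h.ne, h.not_gt, Nat.sub_add_eq]
  · simp
  · obtain ⟨k, hk⟩ : ∃ k, j - u.count true = k + 1 := ⟨j - u.count true - 1, by omega⟩
    simp [hk, h, h.le, h.not_gt, h.ne']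

theorem inShape_col (i j : ℕ) : InShape (u ++ true :: v) i j ↔
    (j < u.count true ∧ (i < v.count false ∨ v.count false ≤ i ∧
      InShape u (i - v.count false) j)) ∨ (j = u.count true ∧ i < v.count false) ∨
      (u.count true < j ∧ InShape v i (j - u.count true - 1)) := by
  rw [inShape_append]
  rcases lt_trichotomy j (u.count true) with h | rfl | h
  · simp [h, h.not_ge, h.ne, h.not_gt]
  · simp
  · obtain ⟨k, hk⟩ : ∃ k, j - u.count true = k + 1 := ⟨j - u.count true - 1, by omega⟩
    simp [hk, h, h.le, h.not_gt, h.ne']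

theorem inShape_row (i j : ℕ) : InShape (u ++ false :: v) i j ↔
    (j < u.count true ∧ (i ≤ v.count false ∨ v.count false < i ∧
      InShape u (i - v.count false - 1) j)) ∨ (u.count true ≤ j ∧ InShape v i (j - u.count true)) := by
  rw [inShape_append]
  simp [Nat.sub_add_eq]

theorem isExtremal_corner :
    IsExtremal (cells (u ++ true :: false :: v)) (v.count false) (u.count true) := by
  refine ⟨?_, ?_, ?_⟩
  · simp [inShape_corner]
  · intro i hi
    simp [inShape_corner]
    omega
  · intro j hj h
    rw [mem_cells, inShape_corner] at h
    rcases h with h | h | h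
    · omega
    · omega
    · exact lt_irrefl _ h.2.lt.1

theorem cells_corner_erase : (cells (u ++ true :: false :: v)).erase (v.count false, u.count true) =
    cells (u ++ false :: true :: v) := by
  ext ⟨i, j⟩
  rw [Finset.mem_erase, mem_cells, mem_cells, inShape_corner, inShape_row]
  have hv := @InShape.lt v i
  rcases lt_trichotomy j (u.count true) with h | rfl | h
  · simp [h, h.not_ge, h.ne, h.not_gt]
  · simp
    omega
  · obtain ⟨k, hk⟩ : ∃ k, j - u.count true = k + 1 := ⟨j - u.count true - 1, by omega⟩
    simp [hk, h, h.le, h.not_gt, h.ne']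

theorem cells_corner_row : {c ∈ cells (u ++ true :: false :: v) | c.1 ≠ v.count false} =
    (cells (u ++ true :: v)).map (relabel (strictMono_skip (v.count false)) strictMono_id) := by
  ext ⟨i, j⟩
  simp only [mem_relabel, id, exists_eq_right, Finset.mem_filter, mem_cells, exists_skip]
  rw [inShape_corner, inShape_col, inShape_col]
  have e : i - 1 - v.count false = i - v.count false - 1 := by omega
  -- Columns to the right of the corner meet only rows of `v`, that is, rows above the deleted one.
  have h1 := @InShape.lt v i (j - u.count true - 1)
  have h2 := @InShape.lt v (i - 1) (j - u.count true - 1)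
  rw [e]
  grind

theorem cells_corner_col : {c ∈ cells (u ++ true :: false :: v) | c.2 ≠ u.count true} =
    (cells (u ++ false :: v)).map (relabel strictMono_id (strictMono_skip (u.count true))) := by
  ext ⟨i, j⟩
  simp only [mem_relabel, id, exists_eq_right, Finset.mem_filter, mem_cells, exists_skip]
  rw [inShape_corner, inShape_row, inShape_row]
  have e : j - 1 - u.count true = j - u.count true - 1 := by omega
  have h1 := @InShape.lt u (i - v.count false - 1) j
  have h2 := @InShape.lt u (i - v.count false - 1) (j - 1)
  rw [e]
  grind

theorem cells_corner_both :
    {c ∈ cells (u ++ true :: false :: v) | c.1 ≠ v.count false ∧ c.2 ≠ u.count true} =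
    (cells (u ++ v)).map
      (relabel (strictMono_skip (v.count false)) (strictMono_skip (u.count true))) := by
  ext ⟨i, j⟩
  simp only [mem_relabel, Finset.mem_filter, mem_cells, exists_skip]
  rw [inShape_corner, inShape_append, inShape_append, inShape_append, inShape_append]
  have e : j - 1 - u.count true = j - u.count true - 1 := by omega
  have e' : i - 1 - v.count false = i - v.count false - 1 := by omega
  have h1 := @InShape.lt u (i - v.count false - 1) j
  have h2 := @InShape.lt u (i - v.count false - 1) (j - 1)
  have h3 := @InShape.lt v i (j - u.count true - 1)
  have h4 := @InShape.lt v (i - 1) (j - u.count true - 1)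
  rw [e, e']
  grind

end Corner

theorem cells_edges {w : List Bool} {i j : ℕ} (h : (i, j) ∈ cells w) :
    (i, 0) ∈ cells w ∧ (0, j) ∈ cells w := by
  simp only [mem_cells] at h ⊢
  exact ⟨h.mono le_rfl (Nat.zero_le _), h.mono (Nat.zero_le _) le_rfl⟩

/-! ### The matrix ansatz for weights of words -/

section Weight

variable {R : Type*} [CommRing R] (a b : R)

/-- Removing the corner cell swaps its two border steps; removing its row or its column deletes the
vertical or the horizontal step. -/
theorem totalWeight_cells_corner (u v : List Bool) (hu : u.count true ≠ 0)
    (hv : v.count false ≠ 0) :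
    totalWeight a b (cells (u ++ true :: false :: v)) =
      totalWeight a b (cells (u ++ false :: true :: v)) + totalWeight a b (cells (u ++ true :: v)) +
        totalWeight a b (cells (u ++ false :: v)) := by
  rw [totalWeight_corner a b (isExtremal_corner u v) hv hu (fun _ _ => cells_edges),
    cells_corner_erase, cells_corner_row, cells_corner_col,
    totalWeight_relabel _ _ _ _ (skip_zero hv) rfl, totalWeight_relabel _ _ _ _ rfl (skip_zero hu)]

theorem totalWeight_cells_corner_top (u : List Bool) (hu : u.count true ≠ 0) :
    totalWeight a b (cells (u ++ [true, false])) = a * totalWeight a b (cells (u ++ [false])) := by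
  rw [totalWeight_corner_top a b (isExtremal_corner u []) hu (fun _ _ h => (cells_edges h).1),
    cells_corner_col, totalWeight_relabel _ _ _ _ rfl (skip_zero hu)]

theorem totalWeight_cells_corner_left (v : List Bool) (hv : v.count false ≠ 0) :
    totalWeight a b (cells (true :: false :: v)) = b * totalWeight a b (cells (true :: v)) := by
  have := totalWeight_corner_left a b (isExtremal_corner [] v) hv
    (fun _ _ h => (cells_edges h).2)
  rw [List.nil_append] at this
  have e := cells_corner_row [] v
  rw [List.nil_append, List.nil_append] at e
  rw [this, e, totalWeight_relabel _ _ _ _ (skip_zero hv) rfl]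

open Classical in
theorem sum_free_cells (u v : List Bool) (hu : u.count true ≠ 0) (hv : v.count false ≠ 0) :
    ∑ S ∈ tableaux (cells (u ++ true :: false :: v)) with
      IsFree S (v.count false) (u.count true), pointWeight a b S =
      a * b * totalWeight a b (cells (u ++ v)) := by
  rw [sum_free a b (isExtremal_corner u v) hv hu (fun _ _ => cells_edges), cells_corner_both,
    totalWeight_relabel _ _ _ _ (skip_zero hv) (skip_zero hu)]

/-- The total weight of the tableaux of the shape encoded by `w`, where the first and the last
step of the border are omitted from `w`. -/
noncomputable def wordWeight (w : List Bool) : R := totalWeight a b (cells (true :: (w ++ [false])))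

theorem wordWeight_nil : wordWeight a b [] = 1 := by
  have hc : cells [true, false] = {(0, 0)} := by
    ext ⟨i, j⟩
    cases j <;> simp
  have ht : tableaux {((0, 0) : ℕ × ℕ)} = {{((0, 0) : ℕ × ℕ)}} := by
    ext S
    rw [mem_tableaux, Finset.mem_singleton]
    constructor
    · intro h
      exact h.subset.antisymm (by simpa using h.root)
    · rintro rfl
      refine ⟨subset_rfl, by simp, by simp, by simp, by simp⟩
  rw [wordWeight, List.nil_append, hc, totalWeight, ht, Finset.sum_singleton]
  simp [pointWeight, Finset.filter_singleton]

theorem wordWeight_false_cons (w : List Bool) :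
    wordWeight a b (false :: w) = b * wordWeight a b w :=
  totalWeight_cells_corner_left a b (w ++ [false]) (by simp)

theorem wordWeight_append_true (w : List Bool) :
    wordWeight a b (w ++ [true]) = a * wordWeight a b w := by
  have := totalWeight_cells_corner_top a b (true :: w) (by simp)
  simpa [wordWeight] using this

theorem wordWeight_corner (u v : List Bool) :
    wordWeight a b (u ++ true :: false :: v) = wordWeight a b (u ++ false :: true :: v) +
      wordWeight a b (u ++ true :: v) + wordWeight a b (u ++ false :: v) := by
  have := totalWeight_cells_corner a b (true :: u) (v ++ [false]) (by simp) (by simp)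
  simpa [wordWeight] using this

/-- The words of length `n`. -/
def words : ℕ → Finset (List Bool)
  | 0 => {[]}
  | n + 1 => (words n).image (List.cons true) ∪ (words n).image (List.cons false)

theorem mem_words {n : ℕ} {w : List Bool} : w ∈ words n ↔ w.length = n := by
  induction n generalizing w with
  | zero => simp [words]
  | succ n ih =>
    rcases w with _ | ⟨_ | _, w⟩ <;> simp [words, ih]

theorem sum_words_succ {M : Type*} [AddCommMonoid M] (n : ℕ) (f : List Bool → M) :
    ∑ w ∈ words (n + 1), f w = ∑ w ∈ words n, (f (true :: w) + f (false :: w)) := by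
  rw [words, Finset.sum_union, Finset.sum_image, Finset.sum_image, Finset.sum_add_distrib]
  · intro x _ y _ h; simpa using h
  · intro x _ y _ h; simpa using h
  · rw [Finset.disjoint_left]
    simp

theorem sum_words_add {M : Type*} [AddCommMonoid M] (m n : ℕ) (f : List Bool → M) :
    ∑ w ∈ words (m + n), f w = ∑ u ∈ words m, ∑ v ∈ words n, f (u ++ v) := by
  induction m generalizing f with
  | zero => simp [words]
  | succ m ih =>
    rw [Nat.add_right_comm, sum_words_succ, sum_words_succ, Finset.sum_add_distrib, ih, ih,
      ← Finset.sum_add_distrib]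
    simp [Finset.sum_add_distrib]

/-- Moving a horizontal step through a sum over all words. -/
theorem sum_wordWeight_true (n : ℕ) (u : List Bool) :
    ∑ w ∈ words n, wordWeight a b (u ++ true :: w) =
      ∑ w ∈ words n, (wordWeight a b (u ++ w ++ [true]) + n * wordWeight a b (u ++ w)) := by
  induction n generalizing u with
  | zero => simp [words]
  | succ n ih =>
    -- The words after `u` begin with DD or DE. The relation turns the latter into ED + D + E: the
    -- terms DD and ED are covered by induction with prefixes `u`D and `u`E, and the leftover D + E
    -- raises the coefficient from `n` to `n + 1`.
    have h1 := ih (u ++ [true])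
    have h2 := ih (u ++ [false])
    simp only [List.append_assoc, List.cons_append, List.nil_append] at h1 h2
    simp only [sum_words_succ, wordWeight_corner, Finset.sum_add_distrib, List.append_assoc,
      List.cons_append, ← Finset.mul_sum] at h1 h2 ⊢
    rw [h1, h2]
    push_cast
    have h := ih u
    ring

/-- Split by first letter. An initial E gives the factor `b`; an initial D, moved to the end, gives
`a + n`. -/
theorem sum_wordWeight (n : ℕ) :
    ∑ w ∈ words n, wordWeight a b w = ∏ i ∈ Finset.range n, (a + b + i) := by
  induction n with
  | zero => simp [words, wordWeight_nil]
  | succ n ih =>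
    rw [sum_words_succ, Finset.sum_add_distrib]
    have := sum_wordWeight_true a b n []
    simp only [List.nil_append] at this
    rw [this]
    simp only [wordWeight_append_true, wordWeight_false_cons, Finset.sum_add_distrib,
      ← Finset.mul_sum]
    rw [ih, Finset.prod_range_succ]
    ring

end Weight

/-! ### Size as number of rows plus columns minus one -/

/-- A point with a point to its left has none above it, so it is the topmost point of its column.
Conversely, the topmost point of each column but the first has its parent to the left. Such points
are therefore in bijection with the columns `1, …, k - 1`. -/
theorem IsTableau.card_left {C S : Finset (ℕ × ℕ)} (hS : IsTableau C S) {k : ℕ}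
    (hk : ∀ j, (0, j) ∈ C ↔ j < k) (h0 : ∀ x y, (x, y) ∈ C → (0, y) ∈ C) :
    {c ∈ S | ∃ j < c.2, (c.1, j) ∈ S}.card = k - 1 := by
  obtain ⟨h1, h2, h3, h4, h5⟩ := hS
  have hno : ∀ x y, (x, y) ∈ S → (∃ j < y, (x, j) ∈ S) → ∀ i < x, (i, y) ∉ S := by
    rintro x y h hl i hi hm
    have hne : (x, y) ≠ (0, 0) := by
      rintro e
      simp only [Prod.mk.injEq] at e
      omega
    rcases h3 _ h hne with h' | h'
    · exact h'.2 hl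
    · exact h'.2 ⟨i, hi, hm⟩
  have himg : {c ∈ S | ∃ j < c.2, (c.1, j) ∈ S}.image Prod.snd = Finset.Ico 1 k := by
    ext j
    simp only [Finset.mem_image, Finset.mem_filter, Finset.mem_Ico, Prod.exists,
      exists_eq_right]
    constructor
    · rintro ⟨i, hi, j', hj', -⟩
      exact ⟨by omega, (hk j).1 (h0 _ _ (h1 hi))⟩
    · rintro ⟨hj, hjk⟩
      classical
      have hex := h5 _ ((hk j).2 hjk)
      refine ⟨Nat.find hex, Nat.find_spec hex, ?_⟩
      have hne : (Nat.find hex, j) ≠ (0, 0) := by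
        rintro e
        simp only [Prod.mk.injEq] at e
        omega
      rcases h3 _ (Nat.find_spec hex) hne with h' | h'
      · obtain ⟨i, hi, hm⟩ := h'.1
        exact absurd hm (Nat.find_min hex hi)
      · exact h'.1
  rw [← Nat.card_Ico 1 k, ← himg, Finset.card_image_of_injOn]
  rintro ⟨x, y⟩ hx ⟨x', y'⟩ hx' e
  simp only [Finset.coe_filter, Set.mem_ofPred_eq] at hx hx' e
  subst e
  have a1 := hno _ _ hx.1 hx.2 x'
  have a2 := hno _ _ hx'.1 hx'.2 x
  rcases lt_trichotomy x x' with h | rfl | h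
  · exact absurd hx.1 (a2 h)
  · rfl
  · exact absurd hx'.1 (a1 h)

theorem IsTableau.card_add_one {C S : Finset (ℕ × ℕ)} (hS : IsTableau C S) {h k : ℕ}
    (hh : ∀ i, (i, 0) ∈ C ↔ i < h) (hk : ∀ j, (0, j) ∈ C ↔ j < k)
    (h0 : ∀ x y, (x, y) ∈ C → (x, 0) ∈ C ∧ (0, y) ∈ C) : S.card + 1 = h + k := by
  have e1 := hS.card_left hk (fun x y h => (h0 x y h).2)
  have e2 := hS.reflect.card_left (k := h) (by simpa using hh)
    (by simpa using fun x y h => (h0 y x h).1)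
  have e3 : {c ∈ flip S | ∃ j < c.2, (c.1, j) ∈ flip S} =
      flip {c ∈ S | ∃ i < c.1, (i, c.2) ∈ S} := by
    ext ⟨i, j⟩
    simp
  rw [e3, flip, Finset.card_map] at e2
  have hd : Disjoint {c ∈ S | ∃ i < c.1, (i, c.2) ∈ S} {c ∈ S | ∃ j < c.2, (c.1, j) ∈ S} := by
    rw [Finset.disjoint_left]
    rintro ⟨x, y⟩ h1 h2
    simp only [Finset.mem_filter] at h1 h2
    have hne : (x, y) ≠ (0, 0) := by
      rintro e
      obtain ⟨-, i, hi, -⟩ := h1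
      simp only [Prod.mk.injEq] at e
      omega
    rcases hS.parent _ h1.1 hne with h' | h'
    · exact h'.2 h2.2
    · exact h'.2 h1.2
  have hu : S.erase (0, 0) =
      {c ∈ S | ∃ i < c.1, (i, c.2) ∈ S} ∪ {c ∈ S | ∃ j < c.2, (c.1, j) ∈ S} := by
    ext ⟨x, y⟩
    simp only [Finset.mem_erase, Finset.mem_union, Finset.mem_filter]
    constructor
    · rintro ⟨hne, hm⟩
      rcases hS.parent _ hm hne with h' | h'
      · exact Or.inl ⟨hm, h'.1⟩
      · exact Or.inr ⟨hm, h'.1⟩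
    · rintro (⟨hm, i, hi, -⟩ | ⟨hm, i, hi, -⟩)
      · refine ⟨?_, hm⟩
        simp only [ne_eq, Prod.mk.injEq]
        omega
      · refine ⟨?_, hm⟩
        simp only [ne_eq, Prod.mk.injEq]
        omega
  have hc := Finset.card_erase_add_one hS.root
  rw [hu, Finset.card_union_of_disjoint hd, e1, e2] at hc
  have p1 := (hh 0).1 (hS.subset hS.root)
  have p2 := (hk 0).1 (hS.subset hS.root)
  omega

/-! ### Diagrams correspond to border words -/

theorem exists_word (h k : ℕ) (p : ℕ → ℕ → Prop)
    (hp : ∀ i j i' j', p i j → i' ≤ i → j' ≤ j → p i' j') (hb : ∀ i j, p i j → i < h ∧ j < k) :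
    ∃ w : List Bool, w.count false = h ∧ w.count true = k ∧ ∀ i j, InShape w i j ↔ p i j := by
  induction hn : h + k generalizing h k p with
  | zero =>
    obtain ⟨rfl, rfl⟩ : h = 0 ∧ k = 0 := by omega
    refine ⟨[], rfl, rfl, fun i j => ?_⟩
    have := hb i j
    simp_all
  | succ n ih =>
    -- If the first column has full height `h`, the border starts with the horizontal step below it.
    -- Otherwise the bottom row is empty and the border starts with a vertical step.
    by_cases hc : k ≠ 0 ∧ ∀ i < h, p i 0
    · obtain ⟨k, rfl⟩ := Nat.exists_eq_succ_of_ne_zero hc.1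
      obtain ⟨w, w1, w2, w3⟩ := ih h k (fun i j => p i (j + 1))
        (fun i j i' j' H hi hj => hp _ _ _ _ H hi (by omega))
        (fun i j H => ⟨(hb _ _ H).1, Nat.lt_of_succ_lt_succ (hb _ _ H).2⟩) (by omega)
      refine ⟨true :: w, by simpa using w1, by simpa using w2, fun i j => ?_⟩
      cases j with
      | zero => simpa [w1] using ⟨hc.2 i, fun H => (hb _ _ H).1⟩
      | succ j => simpa using w3 i j
    · have hn0 : h ≠ 0 := by
        rintro rfl
        exact hc ⟨by omega, by simp⟩
      obtain ⟨h, rfl⟩ := Nat.exists_eq_succ_of_ne_zero hn0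
      have hh : ∀ i j, p i j → i < h := by
        intro i j H
        by_contra hi
        have := hb _ _ H
        exact hc ⟨by omega, fun x hx => hp _ _ _ _ H (by omega) (Nat.zero_le _)⟩
      obtain ⟨w, w1, w2, w3⟩ := ih h k p hp (fun i j H => ⟨hh _ _ H, (hb _ _ H).2⟩) (by omega)
      exact ⟨false :: w, by simpa using w1, by simpa using w2, fun i j => by simpa using w3 i j⟩

theorem word_ext {w w' : List Bool} (hl : w.length = w'.length)
    (hc : w.count false = w'.count false) (h : ∀ i j, InShape w i j ↔ InShape w' i j) :
    w = w' := by
  induction w generalizing w' with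
  | nil => exact (List.length_eq_zero_iff.1 hl.symm).symm
  | cons x w ih =>
    rcases w' with _ | ⟨y, w'⟩
    · simp at hl
    · have hl' : w.length = w'.length := by simpa using hl
      cases x <;> cases y
      · rw [ih hl' (by simpa using hc) (by simpa using h)]
      -- A word starting with D fills its first column down to the last row, while one starting with
      -- E leaves its last row empty. The two shapes differ at the bottom cell of the first column.
      · have := (h (w.count false) 0).2 (by
          rw [inShape_true_zero]
          simp at hc
          omega)
        exact absurd ((inShape_false _ _ _).1 this).lt.1 (lt_irrefl _)
      · have := (h (w'.count false) 0).1 (by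
          rw [inShape_true_zero]
          simp at hc
          omega)
        exact absurd ((inShape_false _ _ _).1 this).lt.1 (lt_irrefl _)
      · rw [ih hl' (by simpa using hc) (fun i j => by simpa using h i (j + 1))]

/-- The border word of a diagram with at least one row and one column, whose interior part
is `w`. -/
def borderWord (w : List Bool) : List Bool := true :: (w ++ [false])

theorem inShape_borderWord_left (w : List Bool) (i : ℕ) :
    InShape (borderWord w) i 0 ↔ i < (borderWord w).count false := by
  simp [borderWord]

theorem inShape_borderWord_top (w : List Bool) (j : ℕ) :
    InShape (borderWord w) 0 j ↔ j < (borderWord w).count true := by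
  have : borderWord w = (true :: w) ++ [false] := rfl
  rw [this, inShape_append]
  simp

theorem borderWord_injOn {w w' : List Bool} (hl : w.length = w'.length)
    (h : cells (borderWord w) = cells (borderWord w')) : w = w' := by
  have hs : ∀ i j, InShape (borderWord w) i j ↔ InShape (borderWord w') i j := by
    intro i j
    rw [← mem_cells, h, mem_cells]
  have hc : (borderWord w).count false = (borderWord w').count false := by
    have := fun i => hs i 0
    simp only [inShape_borderWord_left] at this
    exact le_antisymm (le_of_forall_lt fun i => (this i).1) (le_of_forall_lt fun i => (this i).2)
  have := word_ext (by simp [borderWord, hl]) hc hs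
  simpa [borderWord] using this

/-- A first column of full height forces the initial D, and a first row of full length forces the
final E. -/
theorem eq_borderWord {W : List Bool} {i j : ℕ} (hi : InShape W i 0) (hi' : W.count false ≤ i + 1)
    (hj : InShape W 0 j) (hj' : W.count true ≤ j + 1) : ∃ w, W = borderWord w := by
  rcases W with _ | ⟨x, W⟩
  · exact hi.elim
  cases x
  · have := ((inShape_false _ _ _).1 hi).lt.1
    simp at hi'
    omega
  rcases List.eq_nil_or_concat W with rfl | ⟨w, y, rfl⟩
  · simp at hi
  · cases y
    · exact ⟨w, by simp [borderWord]⟩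
    · have e : true :: w.concat true = (true :: w) ++ [true] := by simp
      rw [e, inShape_append] at hj
      rw [e] at hj'
      rcases hj with hj | hj
      · simp at hj hj'
        omega
      · simpa using hj.2.lt.1

theorem isTableau (T : TreeLikeTableau) : IsTableau T.shape.cells T.points :=
  ⟨T.points_subset, T.root_mem, T.parent, T.row_pointed, T.col_pointed⟩

theorem exists_borderWord (T : TreeLikeTableau) :
    ∃ w : List Bool, w.length + 1 = T.size ∧ cells (borderWord w) = T.shape.cells := by
  have hmem : ∀ i j, (i, j) ∈ T.shape.cells ↔ (i, j) ∈ T.shape := fun i j => Iff.rfl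
  have hh : ∀ i, (i, 0) ∈ T.shape.cells ↔ i < T.shape.colLen 0 := fun i => by
    rw [hmem, YoungDiagram.mem_iff_lt_colLen]
  have hk : ∀ j, (0, j) ∈ T.shape.cells ↔ j < T.shape.rowLen 0 := fun i => by
    rw [hmem, YoungDiagram.mem_iff_lt_rowLen]
  have hlow : ∀ i j i' j', (i, j) ∈ T.shape.cells → i' ≤ i → j' ≤ j → (i', j') ∈ T.shape.cells :=
    fun i j i' j' h hi hj => T.shape.up_left_mem hi hj h
  obtain ⟨W, w1, w2, w3⟩ := exists_word (T.shape.colLen 0) (T.shape.rowLen 0)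
    (fun i j => (i, j) ∈ T.shape.cells) hlow
    (fun i j h => ⟨(hh i).1 (hlow _ _ _ _ h le_rfl (Nat.zero_le _)),
      (hk j).1 (hlow _ _ _ _ h (Nat.zero_le _) le_rfl)⟩)
  have hcard := T.isTableau.card_add_one hh hk
    (fun x y h => ⟨hlow _ _ _ _ h le_rfl (Nat.zero_le _), hlow _ _ _ _ h (Nat.zero_le _) le_rfl⟩)
  have r := T.points_subset T.root_mem
  have p1 := (hh 0).1 r
  have p2 := (hk 0).1 r
  obtain ⟨w, rfl⟩ := eq_borderWord (W := W) (i := T.shape.colLen 0 - 1) (j := T.shape.rowLen 0 - 1)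
    ((w3 _ _).2 ((hh _).2 (by omega))) (by omega) ((w3 _ _).2 ((hk _).2 (by omega))) (by omega)
  refine ⟨w, ?_, ?_⟩
  · have := List.count_true_add_count_false (borderWord w)
    simp only [borderWord, List.length_cons, List.length_append, List.length_nil] at this w1 w2
    rw [size]
    omega
  · ext ⟨i, j⟩
    rw [mem_cells, w3]

theorem IsTableau.card_borderWord {w : List Bool} {S : Finset (ℕ × ℕ)}
    (hS : IsTableau (cells (borderWord w)) S) : S.card = w.length + 1 := by
  have := hS.card_add_one (h := (borderWord w).count false) (k := (borderWord w).count true)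
    (fun i => by rw [mem_cells, inShape_borderWord_left])
    (fun j => by rw [mem_cells, inShape_borderWord_top]) (fun _ _ => cells_edges)
  have h := List.count_true_add_count_false (borderWord w)
  simp only [borderWord, List.length_cons, List.length_append, List.length_nil] at this h
  omega

/-- The tree-like tableau with border word `w` and set of points `S`. -/
noncomputable def ofWord (w : List Bool) (S : Finset (ℕ × ℕ))
    (hS : IsTableau (cells (borderWord w)) S) : TreeLikeTableau where
  shape :=
    { cells := cells (borderWord w)
      isLowerSet := by
        rintro ⟨i, j⟩ ⟨i', j'⟩ h hm
        have hm : (i, j) ∈ cells (borderWord w) := hm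
        exact mem_cells.2 ((mem_cells.1 hm).mono h.1 h.2) }
  points := S
  points_subset := hS.subset
  root_mem := hS.root
  parent := hS.parent
  row_pointed := hS.row
  col_pointed := hS.col

theorem ext_cells {T T' : TreeLikeTableau} (h : T.shape.cells = T'.shape.cells)
    (h' : T.points = T'.points) : T = T' := by
  obtain ⟨⟨s, hs⟩, p, _, _, _, _, _⟩ := T
  obtain ⟨⟨s', hs'⟩, p', _, _, _, _, _⟩ := T'
  simp only at h h'
  subst h h'
  rfl

/-! ### Sums over tableaux and corners as sums over words -/

theorem sum_ofSize {M : Type*} [AddCommMonoid M] (m : ℕ)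
    (f : Finset (ℕ × ℕ) → Finset (ℕ × ℕ) → M) :
    ∑ T : OfSize (m + 1), f T.1.shape.cells T.1.points =
      ∑ w ∈ words m, ∑ S ∈ tableaux (cells (borderWord w)), f (cells (borderWord w)) S := by
  rw [Finset.sum_sigma']
  have hx : ∀ x ∈ (words m).sigma fun w => tableaux (cells (borderWord w)),
      x.1.length = m ∧ IsTableau (cells (borderWord x.1)) x.2 := by
    intro x hx
    rwa [Finset.mem_sigma, mem_words, mem_tableaux] at hx
  symm
  refine Finset.sum_bij
    (fun x h => (⟨ofWord x.1 x.2 (hx x h).2, 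
      (hx x h).2.card_borderWord.trans (congrArg (· + 1) (hx x h).1)⟩ : OfSize (m + 1)))
    (fun _ _ => Finset.mem_univ _) ?_ ?_ (fun _ _ => rfl)
  · rintro ⟨w, S⟩ h ⟨w', S'⟩ h' e
    have e' := congrArg Subtype.val e
    have e1 : cells (borderWord w) = cells (borderWord w') :=
      congrArg (fun T : TreeLikeTableau => T.shape.cells) e'
    have e2 : S = S' := congrArg TreeLikeTableau.points e'
    obtain rfl := borderWord_injOn ((hx _ h).1.trans (hx _ h').1.symm) e1
    rw [e2]
  · rintro ⟨T, hT⟩ -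
    obtain ⟨w, h1, h2⟩ := T.exists_borderWord
    have hS : IsTableau (cells (borderWord w)) T.points := h2 ▸ T.isTableau
    refine ⟨⟨w, T.points⟩, ?_, ?_⟩
    · rw [Finset.mem_sigma, mem_words, mem_tableaux]
      exact ⟨Nat.succ_injective (h1.trans hT), hS⟩
    · exact Subtype.ext (ext_cells h2 rfl)

theorem genPoly_succ {R : Type*} [CommRing R] (m : ℕ) (a b : R) :
    genPoly (m + 1) a b = ∑ w ∈ words m, wordWeight a b w :=
  sum_ofSize m fun _ S => pointWeight a b S

/-- The corners of the diagram with border word `w` outside the first row and column. -/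
noncomputable def innerCorners (w : List Bool) : Finset (ℕ × ℕ) :=
  {c ∈ cells (borderWord w) | ((c.1 + 1, c.2) ∉ cells (borderWord w) ∧
    (c.1, c.2 + 1) ∉ cells (borderWord w)) ∧ c.1 ≠ 0 ∧ c.2 ≠ 0}

theorem exists_split_of_corner {w : List Bool} {i j : ℕ} (h : InShape w i j)
    (hd : ¬ InShape w (i + 1) j) (hr : ¬ InShape w i (j + 1)) :
    ∃ u v, w = u ++ true :: false :: v ∧ v.count false = i ∧ u.count true = j := by
  induction w generalizing j with
  | nil => exact h.elim
  | cons x w ih =>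
    cases x
    · simp only [inShape_false] at h hd hr
      obtain ⟨u, v, rfl, hv, hu⟩ := ih h hd hr
      exact ⟨false :: u, v, rfl, hv, by simpa using hu⟩
    · cases j with
      | zero =>
        simp only [inShape_true_zero, inShape_true_succ] at h hd hr
        rcases w with _ | ⟨_ | _, w⟩
        · simp at h
        · refine ⟨[], w, rfl, ?_, rfl⟩
          simp at h hd
          omega
        · simp at h hd hr
          omega
      | succ j =>
        simp only [inShape_true_succ] at h hd hr
        obtain ⟨u, v, rfl, hv, hu⟩ := ih h hd hr
        exact ⟨true :: u, v, rfl, hv, by simpa using hu⟩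

theorem append_true_inj {u u' s s' : List Bool} (h : u ++ true :: s = u' ++ true :: s')
    (hc : u.count true = u'.count true) : u = u' ∧ s = s' := by
  induction u generalizing u' with
  | nil =>
    rcases u' with _ | ⟨y, u'⟩
    · simpa using h
    · simp only [List.nil_append, List.cons_append, List.cons.injEq] at h
      simp [← h.1] at hc
  | cons x u ih =>
    rcases u' with _ | ⟨y, u'⟩
    · simp only [List.nil_append, List.cons_append, List.cons.injEq] at h
      simp [h.1] at hc
    · simp only [List.cons_append, List.cons.injEq] at h
      obtain ⟨rfl, h⟩ := h
      obtain ⟨rfl, rfl⟩ := ih h (by cases x <;> simpa using hc)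
      exact ⟨rfl, rfl⟩

/-- Inner corners are exactly the factors DE of the interior word, indexed by the length `k` of what
precedes. The shifts by one come from the initial D and the final E of the border. -/
theorem sum_innerCorners {M : Type*} [AddCommMonoid M] (m : ℕ)
    (f : List Bool → ℕ × ℕ → M) :
    ∑ w ∈ words (m + 2), ∑ c ∈ innerCorners w, f w c =
      ∑ k ∈ Finset.range (m + 1), ∑ u ∈ words k, ∑ v ∈ words (m - k),
        f (u ++ true :: false :: v) (v.count false + 1, u.count true + 1) := by
  simp_rw [← Finset.sum_product']
  rw [Finset.sum_sigma', Finset.sum_sigma']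
  symm
  refine Finset.sum_bij (fun x _ => ⟨x.2.1 ++ true :: false :: x.2.2,
    (x.2.2.count false + 1, x.2.1.count true + 1)⟩) ?_ ?_ ?_ (fun _ _ => rfl)
  · rintro ⟨k, u, v⟩ h
    simp only [Finset.mem_sigma, Finset.mem_range, Finset.mem_product, mem_words] at h ⊢
    obtain ⟨hk, rfl, hv⟩ := h
    refine ⟨by simp; omega, ?_⟩
    have hx := isExtremal_corner (true :: u) (v ++ [false])
    have e : (true :: u) ++ true :: false :: (v ++ [false]) =
      borderWord (u ++ true :: false :: v) := by simp [borderWord]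
    have e1 : (v ++ [false]).count false = v.count false + 1 := by simp
    have e2 : (true :: u).count true = u.count true + 1 := by simp
    rw [e, e1, e2] at hx
    exact Finset.mem_filter.2 ⟨hx.mem, ⟨hx.down _ (Nat.lt_succ_self _),
      hx.right _ (Nat.lt_succ_self _)⟩, by simp, by simp⟩
  · rintro ⟨k, u, v⟩ h ⟨k', u', v'⟩ h' e
    simp only [Finset.mem_sigma, Finset.mem_range, Finset.mem_product, mem_words] at h h'
    simp only [Sigma.mk.injEq, heq_eq_eq, Prod.mk.injEq] at e
    obtain ⟨rfl, e'⟩ := append_true_inj e.1 (by omega)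
    simp only [List.cons.injEq, true_and] at e'
    subst e'
    obtain rfl : k = k' := h.2.1.symm.trans h'.2.1
    rfl
  · rintro ⟨w, i, j⟩ h
    simp only [Finset.mem_sigma, mem_words, innerCorners, Finset.mem_filter, mem_cells] at h
    obtain ⟨hw, h1, ⟨h2, h3⟩, hi, hj⟩ := h
    obtain ⟨u, v, e, hv, hu⟩ := exists_split_of_corner h1 h2 h3
    rcases u with _ | ⟨x, u⟩
    · exact absurd hu.symm hj
    rcases List.eq_nil_or_concat v with rfl | ⟨v, y, rfl⟩
    · exact absurd hv.symm hi
    simp only [borderWord, List.cons_append, List.cons.injEq, List.concat_eq_append] at e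
    obtain ⟨rfl, e⟩ := e
    have e' : w ++ [false] = (u ++ true :: false :: v) ++ [y] := by simp [e]
    obtain ⟨rfl, e''⟩ := List.append_inj' e' rfl
    simp only [List.cons.injEq, and_true] at e''
    subst e''
    refine ⟨⟨u.length, u, v⟩, ?_, ?_⟩
    · simp only [Finset.mem_sigma, Finset.mem_range, Finset.mem_product, mem_words, true_and]
      simp at hw
      omega
    · simp only [List.count_cons_self, List.concat_eq_append, List.count_append, List.count_nil]
        at hu hv
      subst hu hv
      simp

/-- Only inner corners matter: a corner in the first row is the sole cell of its column, hence
pointed, and likewise for the first column. -/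
theorem sum_NOCab {R : Type*} [CommRing R] (a b : R) (m : ℕ) :
    ∑ x ∈ NOCab (m + 1), weight a b x.1.1 =
      ∑ w ∈ words m, ∑ c ∈ innerCorners w,
        open Classical in ∑ S ∈ tableaux (cells (borderWord w)) with IsFree S c.1 c.2,
          pointWeight a b S := by
  classical
  have h1 : ∑ x ∈ NOCab (m + 1), weight a b x.1.1 =
      ∑ T : OfSize (m + 1), ∑ c ∈ T.1.shape.cells with
        (((c.1 + 1, c.2) ∉ T.1.shape.cells ∧ (c.1, c.2 + 1) ∉ T.1.shape.cells) ∧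
          IsFree T.1.points c.1 c.2), pointWeight a b T.1.points := by
    rw [NOCab, Finset.sum_sigma]
    refine Finset.sum_congr rfl fun T _ => ?_
    refine Finset.sum_congr (Finset.filter_congr fun c hc => ?_) fun _ _ => rfl
    simp only [IsNOCab, IsNonOccupiedCorner, IsCorner, IsFree, hc, true_and, and_assoc]
  rw [h1, sum_ofSize m fun C S => ∑ c ∈ C with (((c.1 + 1, c.2) ∉ C ∧ (c.1, c.2 + 1) ∉ C) ∧
    IsFree S c.1 c.2), pointWeight a b S]
  refine Finset.sum_congr rfl fun w _ => ?_
  simp_rw [Finset.sum_filter (s := tableaux _)]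
  rw [Finset.sum_comm]
  refine Finset.sum_congr rfl fun S hS => ?_
  rw [← Finset.sum_filter, innerCorners, Finset.filter_filter]
  refine Finset.sum_congr (Finset.filter_congr ?_) fun _ _ => rfl
  rintro ⟨i, j⟩ hc
  have hS := mem_tableaux.1 hS
  refine ⟨?_, fun h => ⟨h.1.1, h.2⟩⟩
  rintro ⟨hd, hf⟩
  refine ⟨⟨hd, ?_⟩, hf⟩
  constructor
  · rintro rfl
    obtain ⟨x, hx⟩ := hS.col _ hc
    rcases Nat.eq_zero_or_pos x with rfl | h
    · exact hf.1 hx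
    · exact hd.1 (mem_cells.2 ((mem_cells.1 (hS.subset hx)).mono h le_rfl))
  · rintro rfl
    obtain ⟨y, hy⟩ := hS.row _ hc
    rcases Nat.eq_zero_or_pos y with rfl | h
    · exact hf.1 hy
    · exact hd.2 (mem_cells.2 ((mem_cells.1 (hS.subset hy)).mono le_rfl h))

theorem sum_NOCab_eq {R : Type*} [CommRing R] (a b : R) (m : ℕ) :
    ∑ x ∈ NOCab (m + 3), weight a b x.1.1 =
      (m + 1) * (a * b) * ∑ w ∈ words m, wordWeight a b w := by
  classical
  rw [sum_NOCab, sum_innerCorners m fun w c =>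
    ∑ S ∈ tableaux (cells (borderWord w)) with IsFree S c.1 c.2, pointWeight a b S]
  have h : ∀ k ∈ Finset.range (m + 1), ∑ u ∈ words k, ∑ v ∈ words (m - k),
      ∑ S ∈ tableaux (cells (borderWord (u ++ true :: false :: v))) with
        IsFree S (v.count false + 1) (u.count true + 1), pointWeight a b S =
      a * b * ∑ w ∈ words m, wordWeight a b w := by
    intro k hk
    have hk' : k + (m - k) = m := by
      have := Finset.mem_range.1 hk
      omega
    -- Cutting every word of length `m` after `k` letters matches the pairs `(u, v)`, so the
    -- contribution does not depend on `k`.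
    conv_rhs => rw [← hk', sum_words_add]
    simp only [Finset.mul_sum]
    refine Finset.sum_congr rfl fun u _ => Finset.sum_congr rfl fun v _ => ?_
    have := sum_free_cells a b (true :: u) (v ++ [false]) (by simp) (by simp)
    simpa [borderWord, wordWeight] using this
  rw [Finset.sum_congr rfl h, Finset.sum_const, Finset.card_range, nsmul_eq_mul]
  push_cast
  ring

end TreeLikeTableau

theorem mainTheorem6 {R : Type*} [CommRing R] (a b : R) (n : ℕ) (hn : 3 ≤ n) :
    ∑ x ∈ TreeLikeTableau.NOCab n, TreeLikeTableau.weight a b x.1.1 =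
        ((n : R) - 2) * (a * b) * TreeLikeTableau.genPoly (n - 2) a b ∧
      TreeLikeTableau.genPoly (n - 2) a b = ∏ i ∈ Finset.range (n - 3), (a + b + (i : R)) := by
  obtain ⟨m, rfl⟩ := Nat.exists_eq_add_of_le' hn
  have e1 : m + 3 - 2 = m + 1 := by omega
  have e2 : m + 3 - 3 = m := by omega
  rw [e1, e2, TreeLikeTableau.genPoly_succ, TreeLikeTableau.sum_NOCab_eq]
  refine ⟨?_, TreeLikeTableau.sum_wordWeight a b m⟩
  push_cast
  ring
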